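/- Let $\mathbb{H}=\{z\in\mathbb{C}:\operatorname{Im} z>0\}$, let $0\le a<b\le\pi$ with $[a,b]\ne[0,\pi]$, and put $\theta=\frac{b-a}{2}\in(0,\pi/2)$, $\xi=e^{i(a+\theta)}$ and $\Delta(\theta)=1/\sqrt{4+\tan^2\theta}$. Let $(a_k),(\gamma_k),(\epsilon_k),(\theta_k)$, $k\ge 1$, be real sequences such that, for all $k\ge1$, $$a_k>0,\quad \gamma_k>0,\quad \epsilon_k>0,\quad \pi\epsilon_k\le\theta,\quad \lim_{j\to\infty}\epsilon_j=0,$$ $$\theta_{2k}+\pi\epsilon_{2k}=\theta,\qquad \theta_{2k-1}-\pi\epsilon_{2k-1}=-\theta,$$ $$\sum_{l=1}^\infty \frac{a_l}{\gamma_l^{\epsilon_l}}\le\frac{\gamma_1}{2},\qquad \gamma_1\ge2,\qquad \gamma_{k+1}>\gamma_k^2,$$ $$\sum_{l=1}^{k-1}\frac{a_l}{\gamma_k^{\epsilon_l}}\le\frac{\Delta(\theta)a_k}{2k\,\gamma_k^{2\epsilon_k}},\qquad \sum_{l=k+1}^\infty\frac{a_l}{\gamma_l^{\epsilon_l}}\le\frac{\Delta(\theta)a_k}{2k\,\gamma_k^{2\epsilon_k}}.$$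 For $z\in\mathbb{C}\setminus(-\infty,0]$ put $$F(z)=z+\sum_{k=1}^\infty\frac{a_ke^{i\theta_k}}{(z+\gamma_k)^{\epsilon_k}}$$ (principal branch of the powers), and let $f(z)=\xi F(\overline{\xi}z)$ for $z\in\mathbb{H}$. Suppose that $\beta\in\mathbb{R}$ and a finite positive Borel measure $\mu$ on $\mathbb{R}$ represent $f$, that is, $$f(z)=z+\beta+\int_{\mathbb{R}}\frac{1+tz}{t-z}\,d\mu(t),\qquad z\in\mathbb{H}.$$ Then: 1. $\mu$ is absolutely continuous with respect to Lebesgue measure on $\mathbb{R}$. More precisely, with $v(z)=\operatorname{Im}(f(z)-z)$, the limit $v^*(x)=\lim_{y\to0^+}v(x+iy)\in[0,+\infty)$ exists for every $x\in\mathbb{R}$, and $d\mu(t)=\dfrac{v^*(t)}{\pi(1+t^2)}\,dt$. 2. If $$\sum_{k=1}^\infty\frac{a_k\log(1+\gamma_k^2)}{\gamma_k^{\epsilon_k}}<+\infty\quad\text{and}\quad\sum_{k=1}^\infty\frac{a_k}{\epsilon_k\gamma_k^{\epsilon_k}}<+\infty,$$ then $\int_{\mathbb{R}}|t|\,d\mu(t)<+\infty$.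 3. If $\int_{\mathbb{R}}|t|\,d\mu(t)<+\infty$ (in particular under the assumptions of 2), then $\beta=\int_{\mathbb{R}}t\,d\mu(t)$. -/

import Mathlib

open MeasureTheory Filter Topology

noncomputable section

namespace SlopeExample

/-- Four real sequences `a_k`, `γ_k`, `ε_k`, `θ_k`, used for `k ≥ 1` only (the value at index `0`
plays no role). -/
structure Coefficients where
  a : ℕ → ℝ
  γ : ℕ → ℝ
  ε : ℕ → ℝ
  ang : ℕ → ℝ

/-- `Δ(θ) = 1 / √(4 + tan² θ)`. -/
def Delta (θ : ℝ) : ℝ := 1 / Real.sqrt (4 + Real.tan θ ^ 2)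

/-- The standing assumptions on the coefficients, for a given opening `θ`.
The series over `l ≥ 1` (resp. `l ≥ k + 1`) is written as a series over `n : ℕ` with
`l = n + 1` (resp. `l = k + 1 + n`). -/
structure Coefficients.Admissible (c : Coefficients) (θ : ℝ) : Prop where
  a_pos : ∀ k, 1 ≤ k → 0 < c.a k
  γ_pos : ∀ k, 1 ≤ k → 0 < c.γ k
  ε_pos : ∀ k, 1 ≤ k → 0 < c.ε k
  ε_le : ∀ k, 1 ≤ k → Real.pi * c.ε k ≤ θ
  ε_tendsto : Tendsto c.ε atTop (𝓝 0)
  ang_even : ∀ k, 1 ≤ k → c.ang (2 * k) + Real.pi * c.ε (2 * k) = θ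
  ang_odd : ∀ k, 1 ≤ k → c.ang (2 * k - 1) - Real.pi * c.ε (2 * k - 1) = -θ
  step_summable : Summable fun n : ℕ => c.a (n + 1) / c.γ (n + 1) ^ c.ε (n + 1)
  step_le : ∑' n : ℕ, c.a (n + 1) / c.γ (n + 1) ^ c.ε (n + 1) ≤ c.γ 1 / 2
  γ_one : 2 ≤ c.γ 1
  γ_growth : ∀ k, 1 ≤ k → c.γ k ^ 2 < c.γ (k + 1)
  head_le : ∀ k, 1 ≤ k →
    ∑ l ∈ Finset.Ico 1 k, c.a l / c.γ k ^ c.ε l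
      ≤ Delta θ * c.a k / (2 * (k : ℝ) * c.γ k ^ (2 * c.ε k))
  tail_le : ∀ k, 1 ≤ k →
    ∑' n : ℕ, c.a (k + 1 + n) / c.γ (k + 1 + n) ^ c.ε (k + 1 + n)
      ≤ Delta θ * c.a k / (2 * (k : ℝ) * c.γ k ^ (2 * c.ε k))

/-- `p_k(z) = a_k e^{iθ_k} / (z + γ_k)^{ε_k}`, with the principal branch of the power. -/
def Coefficients.pTerm (c : Coefficients) (k : ℕ) (z : ℂ) : ℂ :=
  (c.a k : ℂ) * Complex.exp (Complex.I * (c.ang k : ℂ)) / (z + (c.γ k : ℂ)) ^ (c.ε k : ℂ)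

/-- `p(z) = ∑_{k ≥ 1} p_k(z)`. -/
def Coefficients.p (c : Coefficients) (z : ℂ) : ℂ := ∑' n : ℕ, c.pTerm (n + 1) z

/-- `F(z) = z + p(z)`. -/
def Coefficients.F (c : Coefficients) (z : ℂ) : ℂ := z + c.p z

/-- The opening `θ = (b - a) / 2` attached to the interval `[a, b]`. -/
def opening (a b : ℝ) : ℝ := (b - a) / 2

/-- The rotation `ξ = e^{i(a + θ)}` with `θ = (b - a) / 2`. -/
def rot (a b : ℝ) : ℂ := Complex.exp (Complex.I * ((a + opening a b : ℝ) : ℂ))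

/-- The self-map `f(z) = ξ F(ξ̄ z)` of the upper half-plane; only its values at points with
positive imaginary part are used. -/
def Coefficients.f (c : Coefficients) (a b : ℝ) (z : ℂ) : ℂ :=
  rot a b * c.F ((starRingEnd ℂ) (rot a b) * z)

/-- `f` is represented on the upper half-plane by the pair `(β, μ)`:
`f(z) = z + β + ∫ (1 + t z) / (t - z) dμ(t)`. -/
def IsRepresentedBy (f : ℂ → ℂ) (β : ℝ) (μ : Measure ℝ) : Prop :=
  ∀ z : ℂ, 0 < z.im →
    f z = z + (β : ℂ) + ∫ t : ℝ, (1 + (t : ℂ) * z) / ((t : ℂ) - z) ∂μ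

end SlopeExample

end

/-!
Since `f z - z = ξ p(ξ⁻¹ z)`, and the series `p` converges absolutely and uniformly on the closed
half-plane `{w | 0 ≤ Im (ξ w)}`, where `|w + γ_k| ≥ Im ξ · max (|w|, γ_k)`, the function
`Im (f z - z)` extends continuously to the real line. It is also the Poisson integral of the measure
`π (1 + t²) μ`, and the restrictions of a Poisson integral to horizontal lines converge vaguely to
the measure as the line descends to `ℝ`; so that measure has the boundary values as its density.

The same lower bound shows that the `k`-th term of `p` contributes at most a constant multiple of
`a_k ∫ |t| / ((1 + t²) max (|t|, γ_k)^{ε_k}) dt` to the first absolute moment of `μ`. Splitting at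
`|t| = γ_k` bounds this by `a_k (log (1 + γ_k²) / γ_k^{ε_k} + 2 / (ε_k γ_k^{ε_k}))`. Finally, as
`y → ∞`, the difference `f(iy) - iy` tends to `0` by dominated convergence in the series, and to
`β - ∫ t dμ` by dominated convergence in the integral representation.
-/

namespace SlopeExample

open scoped ComplexConjugate

section NevanlinnaKernel

/-- The kernel of the Nevanlinna representation of self-maps of the upper half-plane, as it occurs
in `IsRepresentedBy`. -/
noncomputable def nevanlinnaKernel (z : ℂ) (t : ℝ) : ℂ := (1 + t * z) / (t - z)

lemma measurable_nevanlinnaKernel (z : ℂ) : Measurable (nevanlinnaKernel z) := by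
  unfold nevanlinnaKernel
  fun_prop

lemma im_le_norm_ofReal_sub (t : ℝ) (z : ℂ) : z.im ≤ ‖(t : ℂ) - z‖ := by
  rw [norm_sub_rev]
  simpa using Complex.im_le_norm (z - t)

lemma ofReal_sub_ne_zero (t : ℝ) {z : ℂ} (hz : 0 < z.im) : (t : ℂ) - z ≠ 0 :=
  norm_pos_iff.mp (hz.trans_le (im_le_norm_ofReal_sub t z))

lemma norm_nevanlinnaKernel_le (t : ℝ) {z : ℂ} (hz : 0 < z.im) :
    ‖nevanlinnaKernel z t‖ ≤ ‖z‖ + (1 + ‖z‖ ^ 2) / z.im := by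
  have hsplit : nevanlinnaKernel z t = z + (1 + z ^ 2) / (t - z) := by
    have hne := ofReal_sub_ne_zero t hz
    rw [nevanlinnaKernel]
    field_simp
    ring
  calc ‖nevanlinnaKernel z t‖ ≤ ‖z‖ + ‖1 + z ^ 2‖ / ‖(t : ℂ) - z‖ := by
        rw [hsplit, ← norm_div]
        exact norm_add_le _ _
    _ ≤ ‖z‖ + (1 + ‖z‖ ^ 2) / z.im := by
        gcongr
        · exact (norm_add_le _ _).trans_eq (by rw [norm_one, norm_pow])
        · exact im_le_norm_ofReal_sub t z

lemma integrable_nevanlinnaKernel (μ : Measure ℝ) [IsFiniteMeasure μ] {z : ℂ} (hz : 0 < z.im) :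
    Integrable (nevanlinnaKernel z) μ :=
  .of_bound (measurable_nevanlinnaKernel z).aestronglyMeasurable _
    (ae_of_all _ fun t => norm_nevanlinnaKernel_le t hz)

lemma norm_nevanlinnaKernel_mul_I_le (t : ℝ) {y : ℝ} (hy : 1 ≤ y) :
    ‖nevanlinnaKernel (y * Complex.I) t‖ ≤ 1 + |t| := by
  have hy0 : 0 < y := zero_lt_one.trans_le hy
  have hden : y ≤ ‖(t : ℂ) - y * Complex.I‖ := by
    simpa using im_le_norm_ofReal_sub t (y * Complex.I)
  rw [nevanlinnaKernel, norm_div, div_le_iff₀ (hy0.trans_le hden)]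
  calc ‖1 + (t : ℂ) * (y * Complex.I)‖ ≤ 1 + |t| * y :=
        (norm_add_le _ _).trans_eq (by simp [abs_of_pos hy0])
    _ ≤ (1 + |t|) * y := by linarith
    _ ≤ (1 + |t|) * ‖(t : ℂ) - y * Complex.I‖ := by gcongr

lemma tendsto_nevanlinnaKernel (t : ℝ) :
    Tendsto (fun z => nevanlinnaKernel z t) (comap Complex.im atTop) (𝓝 (-t)) := by
  have hbound : Tendsto (fun z : ℂ => (1 + t ^ 2) / z.im) (comap Complex.im atTop) (𝓝 0) :=
    tendsto_comap.const_div_atTop _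
  refine tendsto_iff_norm_sub_tendsto_zero.mpr (squeeze_zero_norm' ?_ hbound)
  filter_upwards [tendsto_comap.eventually (eventually_gt_atTop 0)] with z hz
  have hne := ofReal_sub_ne_zero t hz
  have hsub : nevanlinnaKernel z t - -t = ((1 + t ^ 2 : ℝ) : ℂ) / (t - z) := by
    rw [nevanlinnaKernel]
    push_cast
    field_simp
    ring
  rw [norm_norm, hsub, norm_div, Complex.norm_of_nonneg (by positivity)]
  gcongr
  exact im_le_norm_ofReal_sub t z

variable {f : ℂ → ℂ} {β : ℝ} {μ : Measure ℝ} [IsFiniteMeasure μ]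

theorem IsRepresentedBy.tendsto_sub (h : IsRepresentedBy f β μ)
    (hμ : Integrable (fun t : ℝ => |t|) μ) :
    Tendsto (fun y : ℝ => f (y * Complex.I) - y * Complex.I) atTop
      (𝓝 ((β - ∫ t, t ∂μ : ℝ) : ℂ)) := by
  have hI : Tendsto (fun y : ℝ => (y : ℂ) * Complex.I) atTop (comap Complex.im atTop) :=
    tendsto_comap_iff.mpr (tendsto_id.congr fun y => by simp)
  have hkernel : Tendsto (fun y : ℝ => ∫ t, nevanlinnaKernel (y * Complex.I) t ∂μ) atTop
      (𝓝 (∫ t : ℝ, -(t : ℂ) ∂μ)) := by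
    refine tendsto_integral_filter_of_dominated_convergence (fun t => 1 + |t|)
      (.of_forall fun y => (measurable_nevanlinnaKernel _).aestronglyMeasurable) ?_
      ((integrable_const _).add hμ) (ae_of_all _ fun t => (tendsto_nevanlinnaKernel t).comp hI)
    filter_upwards [eventually_ge_atTop 1] with y hy
    exact ae_of_all _ fun t => norm_nevanlinnaKernel_mul_I_le t hy
  have hlim : (β : ℂ) + ∫ t : ℝ, -(t : ℂ) ∂μ = ((β - ∫ t, t ∂μ : ℝ) : ℂ) := by
    rw [integral_neg, integral_complex_ofReal, Complex.ofReal_sub, sub_eq_add_neg]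
  refine hlim ▸ (hkernel.const_add (β : ℂ)).congr' ?_
  filter_upwards [eventually_gt_atTop 0] with y hy
  rw [h _ (by simpa using hy)]
  simp only [nevanlinnaKernel]
  ring

end NevanlinnaKernel

section PoissonKernel

open ProbabilityTheory BoundedContinuousFunction

/-- The Poisson kernel of the upper half-plane at `x + i y`, as a function of the boundary point
`t`. The factor `(1 + t ^ 2) / (1 + x ^ 2)` accounts for representing measures being normalised to
be finite. -/
noncomputable def weightedPoisson (x y t : ℝ) : ℝ :=
  (1 + t ^ 2) / (1 + x ^ 2) * cauchyPDFReal t y.toNNReal x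

lemma im_nevanlinnaKernel {z : ℂ} (hz : 0 < z.im) (t : ℝ) :
    (nevanlinnaKernel z t).im = Real.pi * (1 + z.re ^ 2) * weightedPoisson z.re z.im t := by
  have hden : Complex.normSq ((t : ℂ) - z) = (z.re - t) ^ 2 + z.im ^ 2 := by
    simp only [Complex.normSq_apply, Complex.sub_re, Complex.ofReal_re, Complex.sub_im,
      Complex.ofReal_im]
    ring
  have hkernel : (nevanlinnaKernel z t).im =
      z.im * (1 + t ^ 2) / ((z.re - t) ^ 2 + z.im ^ 2) := by
    rw [nevanlinnaKernel, Complex.div_im, hden, ← sub_div]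
    congr 1
    simp only [Complex.add_im, Complex.one_im, Complex.mul_im, Complex.ofReal_re,
      Complex.ofReal_im, Complex.sub_re, Complex.add_re, Complex.one_re, Complex.mul_re,
      Complex.sub_im]
    ring
  rw [hkernel, weightedPoisson, cauchyPDFReal_def, Real.coe_toNNReal _ hz.le]
  field_simp

lemma IsRepresentedBy.im_sub {f : ℂ → ℂ} {β : ℝ} {μ : Measure ℝ} [IsFiniteMeasure μ]
    (h : IsRepresentedBy f β μ) {z : ℂ} (hz : 0 < z.im) :
    (f z - z).im = Real.pi * (1 + z.re ^ 2) * ∫ t, weightedPoisson z.re z.im t ∂μ := by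
  have him : (f z - z).im = (∫ t, nevanlinnaKernel z t ∂μ).im := by
    rw [h z hz]
    simp [nevanlinnaKernel]
  rw [him, ← Complex.imCLM_apply, ← Complex.imCLM.integral_comp_comm
    (integrable_nevanlinnaKernel μ hz), ← integral_const_mul]
  simp only [Complex.imCLM_apply, im_nevanlinnaKernel hz]

lemma cauchyPDFReal_nonneg (x₀ : ℝ) (γ : NNReal) (x : ℝ) : 0 ≤ cauchyPDFReal x₀ γ x := by
  rw [cauchyPDFReal_def]
  positivity

lemma sq_sub_mul_cauchyPDFReal_le (x₀ : ℝ) (γ : NNReal) (x : ℝ) :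
    (x - x₀) ^ 2 * cauchyPDFReal x₀ γ x ≤ Real.pi⁻¹ * γ := by
  rw [cauchyPDFReal_def, ← div_eq_mul_inv, mul_div_left_comm]
  refine mul_le_of_le_one_right (by positivity) (div_le_one_of_le₀ ?_ (by positivity))
  exact le_add_of_nonneg_right (sq_nonneg _)

lemma weightedPoisson_nonneg (x y t : ℝ) : 0 ≤ weightedPoisson x y t :=
  mul_nonneg (by positivity) (cauchyPDFReal_nonneg _ _ _)

lemma continuous_weightedPoisson {y : ℝ} (hy : 0 < y) :
    Continuous fun q : ℝ × ℝ => weightedPoisson q.1 y q.2 := by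
  simp only [weightedPoisson, cauchyPDFReal_def, Real.coe_toNNReal y hy.le]
  have hden (q : ℝ × ℝ) : (q.1 - q.2) ^ 2 + y ^ 2 ≠ 0 := by positivity
  have hweight (q : ℝ × ℝ) : 1 + q.1 ^ 2 ≠ 0 := by positivity
  fun_prop (disch := assumption)

lemma weightedPoisson_le (x : ℝ) {y : ℝ} (hy : 0 < y) (t : ℝ) :
    weightedPoisson x y t ≤
      2 * cauchyPDFReal t y.toNNReal x + 2 * y * cauchyPDFReal 0 1 x := by
  have hweight : 1 + t ^ 2 ≤ 2 * (1 + x ^ 2) + 2 * (x - t) ^ 2 := by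
    nlinarith [sq_nonneg (t - 2 * x)]
  have hpos := cauchyPDFReal_nonneg t y.toNNReal x
  have htail := sq_sub_mul_cauchyPDFReal_le t y.toNNReal x
  rw [Real.coe_toNNReal y hy.le] at htail
  calc weightedPoisson x y t
      ≤ (2 * (1 + x ^ 2) + 2 * (x - t) ^ 2) / (1 + x ^ 2) * cauchyPDFReal t y.toNNReal x := by
        unfold weightedPoisson
        gcongr
    _ = 2 * cauchyPDFReal t y.toNNReal x +
          2 * ((x - t) ^ 2 * cauchyPDFReal t y.toNNReal x) / (1 + x ^ 2) := by
        field_simp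
    _ ≤ 2 * cauchyPDFReal t y.toNNReal x + 2 * (Real.pi⁻¹ * y) / (1 + x ^ 2) := by gcongr
    _ = _ := by
        rw [cauchyPDFReal_def 0 1]
        simp only [NNReal.coe_one, sub_zero, one_pow, mul_one, add_comm (x ^ 2)]
        field_simp

lemma integrable_weightedPoisson (y t : ℝ) : Integrable fun x => weightedPoisson x y t := by
  refine (integrable_cauchyPDFReal t).bdd_mul (c := 1 + t ^ 2)
    (by fun_prop : Measurable fun x : ℝ => (1 + t ^ 2) / (1 + x ^ 2)).aestronglyMeasurable
    (ae_of_all _ fun x => ?_)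
  rw [Real.norm_of_nonneg (by positivity)]
  exact div_le_self (by positivity) (le_add_of_nonneg_right (sq_nonneg x))

lemma integral_weightedPoisson_le {y : ℝ} (hy : 0 < y) (t : ℝ) :
    ∫ x, weightedPoisson x y t ≤ 2 + 2 * y := by
  have h₁ : Integrable fun x => 2 * cauchyPDFReal t y.toNNReal x :=
    (integrable_cauchyPDFReal t).const_mul 2
  have h₂ : Integrable fun x => 2 * y * cauchyPDFReal 0 1 x :=
    (integrable_cauchyPDFReal 0).const_mul (2 * y)
  refine (integral_mono (integrable_weightedPoisson y t) (h₁.add h₂)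
    fun x => weightedPoisson_le x hy t).trans_eq ?_
  simp only [Pi.add_apply]
  rw [integral_add h₁ h₂, integral_const_mul, integral_const_mul,
    integral_cauchyPDFReal_eq_one t (Real.toNNReal_pos.mpr hy).ne',
    integral_cauchyPDFReal_eq_one 0 one_ne_zero, mul_one, mul_one]

lemma tendsto_integral_cauchyPDFReal {φ : ℝ → ℝ} (hφ : Integrable φ) {t : ℝ}
    (ht : ContinuousAt φ t) :
    Tendsto (fun y : ℝ => ∫ x, cauchyPDFReal t y.toNNReal x * φ x) (𝓝[>] 0) (𝓝 (φ t)) := by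
  have hdecay : Tendsto (fun x : ℝ => ‖x‖ ^ Module.finrank ℝ ℝ * cauchyPDFReal 0 1 x)
      (Bornology.cobounded ℝ) (𝓝 0) := by
    refine squeeze_zero (fun x => mul_nonneg (by positivity) (cauchyPDFReal_nonneg _ _ _))
      (fun x => ?_) (tendsto_inv_atTop_zero.comp (tendsto_norm_cobounded_atTop (E := ℝ)))
    rcases eq_or_ne x 0 with rfl | hx
    · simp
    have hle : x ^ 2 * cauchyPDFReal 0 1 x ≤ 1 := by
      have h := sq_sub_mul_cauchyPDFReal_le 0 1 x
      rw [sub_zero, NNReal.coe_one, mul_one] at h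
      exact h.trans (inv_le_one_of_one_le₀ (by linarith [Real.pi_gt_three]))
    rw [Module.finrank_self, pow_one, Function.comp_apply, ← one_div,
      le_div_iff₀ (norm_pos_iff.mpr hx), mul_right_comm, ← sq, Real.norm_eq_abs, sq_abs]
    exact hle
  have happrox := (tendsto_integral_comp_smul_smul_of_integrable' (cauchyPDFReal_nonneg 0 1)
    (integral_cauchyPDFReal_eq_one 0 one_ne_zero) hdecay hφ ht).comp tendsto_inv_nhdsGT_zero
  refine happrox.congr' ?_
  filter_upwards [self_mem_nhdsWithin] with y (hy : 0 < y)
  refine integral_congr_ae (ae_of_all _ fun x => ?_)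
  simp only [cauchyPDFReal_def, Real.coe_toNNReal y hy.le, smul_eq_mul, Module.finrank_self,
    NNReal.coe_one, pow_one]
  field_simp
  ring

variable (ψ : ℝ →ᵇ ℝ)

lemma tendsto_integral_mul_weightedPoisson (t : ℝ) :
    Tendsto (fun y => ∫ x, ψ x * weightedPoisson x y t) (𝓝[>] 0) (𝓝 (ψ t)) := by
  have hint : Integrable fun x => (1 + x ^ 2)⁻¹ * ψ x :=
    integrable_inv_one_add_sq.mul_bdd (c := ‖ψ‖) ψ.continuous.aestronglyMeasurable
      (ae_of_all _ ψ.norm_coe_le_norm)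
  have hcont : ContinuousAt (fun x => (1 + x ^ 2)⁻¹ * ψ x) t :=
    ContinuousAt.mul (ContinuousAt.inv₀ (by fun_prop) (by positivity)) ψ.continuous.continuousAt
  convert (tendsto_integral_cauchyPDFReal hint hcont).const_mul (1 + t ^ 2) using 2 with y
  · rw [← integral_const_mul]
    congr 1 with x
    rw [weightedPoisson]
    ring
  · field_simp

lemma norm_mul_weightedPoisson_le (x y t : ℝ) :
    ‖ψ x * weightedPoisson x y t‖ ≤ ‖ψ‖ * weightedPoisson x y t := by
  rw [norm_mul, Real.norm_of_nonneg (weightedPoisson_nonneg x y t)]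
  gcongr
  exacts [weightedPoisson_nonneg x y t, ψ.norm_coe_le_norm x]

lemma integrable_mul_weightedPoisson (y t : ℝ) :
    Integrable fun x => ψ x * weightedPoisson x y t :=
  (integrable_weightedPoisson y t).bdd_mul ψ.continuous.aestronglyMeasurable
    (ae_of_all _ ψ.norm_coe_le_norm)

lemma integral_norm_mul_weightedPoisson_le {y : ℝ} (hy : 0 < y) (t : ℝ) :
    ∫ x, ‖ψ x * weightedPoisson x y t‖ ≤ ‖ψ‖ * (2 + 2 * y) := by
  refine (integral_mono (integrable_mul_weightedPoisson ψ y t).norm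
    ((integrable_weightedPoisson y t).const_mul ‖ψ‖)
    fun x => norm_mul_weightedPoisson_le ψ x y t).trans ?_
  rw [integral_const_mul]
  gcongr
  exact integral_weightedPoisson_le hy t

lemma continuous_mul_weightedPoisson {y : ℝ} (hy : 0 < y) :
    Continuous fun q : ℝ × ℝ => ψ q.2 * weightedPoisson q.2 y q.1 :=
  (ψ.continuous.comp continuous_snd).mul ((continuous_weightedPoisson hy).comp continuous_swap)

variable (μ : Measure ℝ) [IsFiniteMeasure μ]

lemma integral_mul_integral_weightedPoisson {y : ℝ} (hy : 0 < y) :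
    ∫ x, ψ x * ∫ t, weightedPoisson x y t ∂μ =
      ∫ t, (∫ x, ψ x * weightedPoisson x y t) ∂μ := by
  have hmeas := (continuous_mul_weightedPoisson ψ hy).aestronglyMeasurable (μ := μ.prod volume)
  have hint : Integrable (fun q : ℝ × ℝ => ψ q.2 * weightedPoisson q.2 y q.1) (μ.prod volume) := by
    refine (integrable_prod_iff hmeas).mpr ⟨ae_of_all _ (integrable_mul_weightedPoisson ψ y),
      .of_bound hmeas.norm.integral_prod_right' (‖ψ‖ * (2 + 2 * y)) (ae_of_all _ fun t => ?_)⟩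
    rw [Real.norm_of_nonneg (integral_nonneg fun x => norm_nonneg _)]
    exact integral_norm_mul_weightedPoisson_le ψ hy t
  simp only [← integral_const_mul]
  exact (integral_integral_swap (f := fun t x => ψ x * weightedPoisson x y t) hint).symm

lemma tendsto_integral_mul_integral_weightedPoisson :
    Tendsto (fun y => ∫ x, ψ x * ∫ t, weightedPoisson x y t ∂μ) (𝓝[>] 0) (𝓝 (∫ t, ψ t ∂μ)) := by
  have hdom : Tendsto (fun y => ∫ t, (∫ x, ψ x * weightedPoisson x y t) ∂μ) (𝓝[>] 0)
      (𝓝 (∫ t, ψ t ∂μ)) := by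
    refine tendsto_integral_filter_of_dominated_convergence (fun _ => ‖ψ‖ * (2 + 2 * 1)) ?_ ?_
      (integrable_const _) (ae_of_all _ (tendsto_integral_mul_weightedPoisson ψ))
    · filter_upwards [self_mem_nhdsWithin] with y hy
      exact ((continuous_mul_weightedPoisson ψ hy).aestronglyMeasurable
        (μ := μ.prod volume)).integral_prod_right'
    · filter_upwards [Ioc_mem_nhdsGT one_pos] with y hy
      refine ae_of_all _ fun t => (norm_integral_le_integral_norm _).trans
        ((integral_norm_mul_weightedPoisson_le ψ hy.1 t).trans ?_)
      gcongr
      exact hy.2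
  refine hdom.congr' ?_
  filter_upwards [self_mem_nhdsWithin] with y hy
  exact (integral_mul_integral_weightedPoisson ψ μ hy).symm

end PoissonKernel

section BoundaryValues

open CompactlySupported

variable {w : ℂ → ℝ} (hw : ContinuousOn w {z | 0 ≤ z.im})

include hw

lemma tendsto_boundary (x : ℝ) :
    Tendsto (fun y : ℝ => w (x + y * Complex.I)) (𝓝[>] 0) (𝓝 (w x)) := by
  have hline : Tendsto (fun y : ℝ => (x : ℂ) + y * Complex.I) (𝓝[>] 0) (𝓝[{z | 0 ≤ z.im}] x) := by
    refine tendsto_nhdsWithin_iff.mpr ⟨?_, ?_⟩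
    · have hcont : Continuous fun y : ℝ => (x : ℂ) + y * Complex.I := by fun_prop
      simpa using (hcont.tendsto 0).mono_left nhdsWithin_le_nhds
    · filter_upwards [self_mem_nhdsWithin] with y (hy : 0 < y)
      simpa using hy.le
  exact (hw x (by simp)).tendsto.comp hline

lemma continuous_boundary : Continuous fun x : ℝ => w x :=
  hw.comp_continuous Complex.continuous_ofReal fun _ => by simp

lemma tendsto_integral_mul_boundary (ψ : C_c(ℝ, ℝ)) :
    Tendsto (fun y : ℝ => ∫ x, ψ x * w (x + y * Complex.I)) (𝓝[>] 0) (𝓝 (∫ x, ψ x * w x)) := by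
  have hjoint : ContinuousOn (Function.uncurry fun y x : ℝ => ψ x * w (x + y * Complex.I))
      (Set.Ici 0 ×ˢ Set.univ) := by
    refine (ψ.continuous.comp continuous_snd).continuousOn.mul (hw.comp (by fun_prop) ?_)
    rintro ⟨y, x⟩ ⟨hy : 0 ≤ y, -⟩
    simpa using hy
  have hcont := continuousOn_integral_of_compact_support (μ := volume) ψ.hasCompactSupport hjoint
    fun y _ _ hx => by simp [image_eq_zero_of_notMem_tsupport hx]
  simpa using ((hcont 0 Set.self_mem_Ici).tendsto.mono_left
    (nhdsWithin_mono 0 Set.Ioi_subset_Ici_self))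

variable {μ : Measure ℝ} (hμ : ∀ z : ℂ, 0 < z.im → w z = ∫ t, weightedPoisson z.re z.im t ∂μ)

include hμ

lemma boundary_nonneg (x : ℝ) : 0 ≤ w x := by
  refine ge_of_tendsto (tendsto_boundary hw x) ?_
  filter_upwards [self_mem_nhdsWithin] with y (hy : 0 < y)
  rw [hμ _ (by simpa using hy)]
  exact integral_nonneg fun t => weightedPoisson_nonneg _ _ t

variable [IsFiniteMeasure μ]

lemma integral_eq_integral_mul_boundary (ψ : C_c(ℝ, ℝ)) : ∫ t, ψ t ∂μ = ∫ x, ψ x * w x := by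
  refine tendsto_nhds_unique (tendsto_integral_mul_integral_weightedPoisson
    ψ.toBoundedContinuousFunction μ)
    ((tendsto_integral_mul_boundary hw ψ).congr' ?_)
  filter_upwards [self_mem_nhdsWithin] with y (hy : 0 < y)
  refine integral_congr_ae (ae_of_all _ fun x => ?_)
  simp [hμ (x + y * Complex.I) (by simpa using hy)]

/-- **Stieltjes inversion**. -/
theorem eq_withDensity_boundary :
    μ = volume.withDensity fun x : ℝ => ENNReal.ofReal (w x) := by
  have hcont := continuous_boundary hw
  have _ := IsLocallyFiniteMeasure.withDensity_ofReal (μ := volume) hcont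
  refine Measure.ext_of_integral_eq_on_compactlySupported fun ψ => ?_
  rw [integral_eq_integral_mul_boundary hw hμ ψ, integral_withDensity_eq_integral_toReal_smul
    hcont.measurable.ennreal_ofReal (ae_of_all _ fun _ => ENNReal.ofReal_lt_top)]
  refine integral_congr_ae (ae_of_all _ fun x => ?_)
  simp only [ENNReal.toReal_ofReal (boundary_nonneg hw hμ x), smul_eq_mul, mul_comm]

end BoundaryValues

section RotatedHalfPlane

/-- The closed half-plane `ξ⁻¹ · {z | 0 ≤ Im z}`, on which the rotated map is evaluated. -/
def rotatedHalfPlane (ξ : ℂ) : Set ℂ := {w | 0 ≤ (ξ * w).im}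

variable {ξ w : ℂ}

lemma mul_conj_of_norm_eq_one (hξ : ‖ξ‖ = 1) : ξ * conj ξ = 1 := by
  rw [Complex.mul_conj, Complex.normSq_eq_norm_sq, hξ, one_pow, Complex.ofReal_one]

lemma conj_mul_mem_rotatedHalfPlane (hξ : ‖ξ‖ = 1) {z : ℂ} (hz : 0 ≤ z.im) :
    conj ξ * z ∈ rotatedHalfPlane ξ := by
  change 0 ≤ (ξ * (conj ξ * z)).im
  rwa [← mul_assoc, mul_conj_of_norm_eq_one hξ, one_mul]

lemma im_mul_add_ofReal (ξ w : ℂ) (g : ℝ) : (ξ * (w + g)).im = (ξ * w).im + ξ.im * g := by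
  rw [mul_add, Complex.add_im, Complex.im_mul_ofReal]

lemma add_ofReal_mem_slitPlane (hi : 0 < ξ.im) (hw : w ∈ rotatedHalfPlane ξ) {g : ℝ}
    (hg : 0 < g) : w + g ∈ Complex.slitPlane := by
  have hpos : 0 < (ξ * (w + g)).im := by
    rw [im_mul_add_ofReal]
    exact add_pos_of_nonneg_of_pos hw (mul_pos hi hg)
  by_contra h
  obtain ⟨hre, him⟩ : (w + g).re ≤ 0 ∧ (w + g).im = 0 := by
    simpa [Complex.mem_slitPlane_iff] using h
  rw [Complex.mul_im, him, mul_zero, zero_add] at hpos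
  exact hpos.not_ge (mul_nonpos_of_nonneg_of_nonpos hi.le hre)

lemma im_mul_norm_le_norm_add (hξ : ‖ξ‖ = 1) (hi : 0 ≤ ξ.im) (hw : w ∈ rotatedHalfPlane ξ)
    {g : ℝ} (hg : 0 ≤ g) : ξ.im * ‖w‖ ≤ ‖w + g‖ := by
  have hsq (z : ℂ) : ‖z‖ ^ 2 = z.re ^ 2 + z.im ^ 2 := by
    rw [← Complex.normSq_eq_norm_sq, Complex.normSq_apply, sq, sq]
  have hcircle : ξ.re ^ 2 + ξ.im ^ 2 = 1 := by rw [← hsq, hξ, one_pow]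
  refine le_of_sq_le_sq ?_ (norm_nonneg _)
  rw [mul_pow, hsq, hsq]
  simp only [Complex.add_re, Complex.add_im, Complex.ofReal_re, Complex.ofReal_im, add_zero]
  rcases le_or_gt 0 w.re with hre | hre
  · have hle : ξ.im ^ 2 ≤ 1 := by linarith [sq_nonneg ξ.re]
    have hadd : w.re ^ 2 ≤ (w.re + g) ^ 2 := by
      gcongr
      exact le_add_of_nonneg_right hg
    exact (mul_le_of_le_one_left (by positivity) hle).trans (add_le_add_left hadd _)
  · have hw' : 0 ≤ ξ.re * w.im + ξ.im * w.re := hw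
    have hside : (ξ.im * w.re) ^ 2 ≤ (ξ.re * w.im) ^ 2 :=
      sq_le_sq' (by nlinarith) (by nlinarith)
    nlinarith [sq_nonneg (w.re + g)]

lemma im_mul_max_le_norm_add (hξ : ‖ξ‖ = 1) (hi : 0 ≤ ξ.im) (hw : w ∈ rotatedHalfPlane ξ)
    {g : ℝ} (hg : 0 ≤ g) : ξ.im * max ‖w‖ g ≤ ‖w + g‖ := by
  rw [mul_max_of_nonneg _ _ hi]
  refine max_le (im_mul_norm_le_norm_add hξ hi hw hg) ?_
  calc ξ.im * g ≤ (ξ * (w + g)).im := by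
        rw [im_mul_add_ofReal]
        exact le_add_of_nonneg_left hw
    _ ≤ ‖ξ * (w + g)‖ := Complex.im_le_norm _
    _ = ‖w + g‖ := by rw [norm_mul, hξ, one_mul]

end RotatedHalfPlane

section Coefficients

variable {c : Coefficients} {M : ℝ} {ξ w : ℂ}

/-- Nonnegative `a_k` and positive `γ_k`, `ε_k` with exponents bounded by `M`, for `k ≥ 1`, such
that the series defining `p` converges absolutely at the origin. -/
structure Coefficients.AbsSummable (c : Coefficients) (M : ℝ) : Prop where
  a_nonneg (n : ℕ) : 0 ≤ c.a (n + 1)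
  γ_pos (n : ℕ) : 0 < c.γ (n + 1)
  ε_pos (n : ℕ) : 0 < c.ε (n + 1)
  ε_le (n : ℕ) : c.ε (n + 1) ≤ M
  summable : Summable fun n => c.a (n + 1) / c.γ (n + 1) ^ c.ε (n + 1)

lemma Coefficients.Admissible.absSummable {θ : ℝ} (hc : c.Admissible θ) :
    c.AbsSummable (θ / Real.pi) where
  a_nonneg n := (hc.a_pos _ n.succ_pos).le
  γ_pos n := hc.γ_pos _ n.succ_pos
  ε_pos n := hc.ε_pos _ n.succ_pos
  ε_le n := (le_div_iff₀' Real.pi_pos).mpr (hc.ε_le _ n.succ_pos)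
  summable := hc.step_summable

lemma div_rpow_le {a e r s x : ℝ} (ha : 0 ≤ a) (hs : 0 < s) (hs1 : s ≤ 1) (hx : 0 < x)
    (he : 0 ≤ e) (heM : e ≤ M) (hr : s * x ≤ r) : a / r ^ e ≤ s ^ (-M) * (a / x ^ e) := by
  have hpow : s ^ M * x ^ e ≤ r ^ e :=
    calc s ^ M * x ^ e ≤ s ^ e * x ^ e := by
          gcongr ?_ * _
          exact Real.rpow_le_rpow_of_exponent_ge hs hs1 heM
      _ = (s * x) ^ e := (Real.mul_rpow hs.le hx.le).symm
      _ ≤ r ^ e := by gcongr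
  calc a / r ^ e ≤ a / (s ^ M * x ^ e) := by gcongr
    _ = s ^ (-M) * (a / x ^ e) := by
        rw [Real.rpow_neg hs.le]
        field_simp

lemma Coefficients.norm_pTerm {k : ℕ} (ha : 0 ≤ c.a k) (w : ℂ) :
    ‖c.pTerm k w‖ = c.a k / ‖w + c.γ k‖ ^ c.ε k := by
  rw [pTerm, norm_div, norm_mul, Complex.norm_cpow_real, mul_comm Complex.I,
    Complex.norm_exp_ofReal_mul_I, mul_one, Complex.norm_of_nonneg ha]

namespace Coefficients.AbsSummable

variable (hc : c.AbsSummable M)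

include hc

lemma continuousAt_pTerm (hi : 0 < ξ.im) (hw : w ∈ rotatedHalfPlane ξ) (n : ℕ) :
    ContinuousAt (c.pTerm (n + 1)) w := by
  have hslit := add_ofReal_mem_slitPlane hi hw (hc.γ_pos n)
  refine continuousAt_const.div (ContinuousAt.cpow (by fun_prop) continuousAt_const hslit) ?_
  exact Complex.cpow_ne_zero_iff.mpr (.inl (Complex.slitPlane_ne_zero hslit))

lemma tendsto_pTerm (n : ℕ) : Tendsto (c.pTerm (n + 1)) (Bornology.cobounded ℂ) (𝓝 0) := by
  rw [tendsto_zero_iff_norm_tendsto_zero]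
  simp only [norm_pTerm (hc.a_nonneg n)]
  have hnorm := tendsto_norm_cobounded_atTop.comp
    (tendsto_add_const_cobounded (c.γ (n + 1) : ℂ))
  exact ((tendsto_rpow_atTop (hc.ε_pos n)).comp hnorm).const_div_atTop _

variable (hξ : ‖ξ‖ = 1) (hi : 0 < ξ.im)

include hξ hi

lemma norm_pTerm_le_max (hw : w ∈ rotatedHalfPlane ξ) (n : ℕ) :
    ‖c.pTerm (n + 1) w‖ ≤
      ξ.im ^ (-M) * (c.a (n + 1) / max ‖w‖ (c.γ (n + 1)) ^ c.ε (n + 1)) := by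
  rw [norm_pTerm (hc.a_nonneg n)]
  exact div_rpow_le (hc.a_nonneg n) hi (hξ ▸ Complex.im_le_norm ξ)
    (lt_max_of_lt_right (hc.γ_pos n)) (hc.ε_pos n).le (hc.ε_le n)
    (im_mul_max_le_norm_add hξ hi.le hw (hc.γ_pos n).le)

lemma norm_pTerm_le (hw : w ∈ rotatedHalfPlane ξ) (n : ℕ) :
    ‖c.pTerm (n + 1) w‖ ≤ ξ.im ^ (-M) * (c.a (n + 1) / c.γ (n + 1) ^ c.ε (n + 1)) := by
  have ha := hc.a_nonneg n
  have hγ := hc.γ_pos n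
  have hε := hc.ε_pos n
  refine (hc.norm_pTerm_le_max hξ hi hw n).trans ?_
  gcongr
  exact le_max_right _ _

lemma continuousOn_p : ContinuousOn c.p (rotatedHalfPlane ξ) :=
  continuousOn_tsum (fun n _ hw => (hc.continuousAt_pTerm hi hw n).continuousWithinAt)
    (hc.summable.mul_left (ξ.im ^ (-M))) fun n _ hw => hc.norm_pTerm_le hξ hi hw n

lemma tendsto_p :
    Tendsto c.p (Bornology.cobounded ℂ ⊓ 𝓟 (rotatedHalfPlane ξ)) (𝓝 0) := by
  have htsum := tendsto_tsum_of_dominated_convergence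
    (𝓕 := Bornology.cobounded ℂ ⊓ 𝓟 (rotatedHalfPlane ξ))
    (f := fun w n => c.pTerm (n + 1) w)
    (hc.summable.mul_left (ξ.im ^ (-M)))
    (fun n => (hc.tendsto_pTerm n).mono_left inf_le_left)
    (eventually_inf_principal.mpr (.of_forall fun w hw n => hc.norm_pTerm_le hξ hi hw n))
  rwa [tsum_zero] at htsum

end Coefficients.AbsSummable

end Coefficients

section Rotation

open Coefficients

/-- The map `f`, with an arbitrary rotation `ξ` in place of `e^{i(a + θ)}`. -/
noncomputable def Coefficients.rotated (c : Coefficients) (ξ z : ℂ) : ℂ := ξ * c.F (conj ξ * z)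

variable {c : Coefficients} {ξ : ℂ}

lemma Coefficients.rotated_sub (hξ : ‖ξ‖ = 1) (z : ℂ) :
    c.rotated ξ z - z = ξ * c.p (conj ξ * z) := by
  rw [rotated, F, mul_add, ← mul_assoc, mul_conj_of_norm_eq_one hξ, one_mul, add_sub_cancel_left]

variable {M : ℝ} (hc : c.AbsSummable M) (hξ : ‖ξ‖ = 1) (hi : 0 < ξ.im)

include hc hξ hi

lemma Coefficients.AbsSummable.continuousOn_rotated_sub :
    ContinuousOn (fun z => c.rotated ξ z - z) {z | 0 ≤ z.im} := by
  simp only [rotated_sub hξ]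
  exact ((hc.continuousOn_p hξ hi).comp (by fun_prop)
    fun z hz => conj_mul_mem_rotatedHalfPlane hξ hz).const_mul ξ

lemma Coefficients.AbsSummable.tendsto_rotated_sub :
    Tendsto (fun y : ℝ => c.rotated ξ (y * Complex.I) - y * Complex.I) atTop (𝓝 0) := by
  have hray : Tendsto (fun y : ℝ => conj ξ * (y * Complex.I)) atTop
      (Bornology.cobounded ℂ ⊓ 𝓟 (rotatedHalfPlane ξ)) := by
    refine tendsto_inf.mpr ⟨tendsto_norm_atTop_iff_cobounded.mp ?_, tendsto_principal.mpr ?_⟩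
    · simpa [hξ] using tendsto_abs_atTop_atTop
    · filter_upwards [eventually_ge_atTop 0] with y hy
      exact conj_mul_mem_rotatedHalfPlane hξ (by simpa using hy)
  simp only [rotated_sub hξ]
  simpa using ((hc.tendsto_p hξ hi).comp hray).const_mul ξ

end Rotation

section DecayWeight

variable {g e : ℝ}

/-- The density, up to constants, that the `k`-th term of `p` contributes to the first absolute
moment of the representing measure at distance `r` from the origin, with `g = γ_k` and
`e = ε_k`. -/
noncomputable def decayWeight (g e r : ℝ) : ℝ := r / (1 + r ^ 2) / max r g ^ e

lemma decayWeight_nonneg {r : ℝ} (hr : 0 ≤ r) : 0 ≤ decayWeight g e r :=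
  div_nonneg (by positivity) (Real.rpow_nonneg (hr.trans (le_max_left r g)) e)

lemma continuous_decayWeight (hg : 0 < g) (he : 0 ≤ e) : Continuous (decayWeight g e) := by
  have hmax (r : ℝ) : max r g ^ e ≠ 0 := (Real.rpow_pos_of_pos (lt_max_of_lt_right hg) e).ne'
  refine Continuous.div (Continuous.div (by fun_prop) (by fun_prop) fun r => by positivity) ?_ hmax
  exact Continuous.rpow_const (by fun_prop) fun _ => .inr he

lemma integral_div_one_add_sq (g : ℝ) :
    ∫ r in (0 : ℝ)..g, r / (1 + r ^ 2) = Real.log (1 + g ^ 2) / 2 := by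
  have hderiv (r : ℝ) :
      HasDerivAt (fun r : ℝ => Real.log (1 + r ^ 2) / 2) (r / (1 + r ^ 2)) r := by
    have hpos : 1 + r ^ 2 ≠ 0 := by positivity
    refine ((((hasDerivAt_pow 2 r).const_add 1).log hpos).div_const 2).congr_deriv ?_
    rw [Nat.cast_ofNat, pow_one]
    ring
  have hcont : Continuous fun r : ℝ => r / (1 + r ^ 2) :=
    Continuous.div (by fun_prop) (by fun_prop) fun r => by positivity
  rw [intervalIntegral.integral_eq_sub_of_hasDerivAt (fun r _ => hderiv r)
    (hcont.intervalIntegrable _ _)]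
  simp

lemma integral_decayWeight_Ioc (hg : 0 ≤ g) :
    ∫ r in Set.Ioc 0 g, decayWeight g e r = Real.log (1 + g ^ 2) / 2 / g ^ e := by
  rw [← integral_div_one_add_sq, intervalIntegral.integral_of_le hg, ← integral_div]
  refine setIntegral_congr_fun measurableSet_Ioc fun r hr => ?_
  simp only [decayWeight, max_eq_right hr.2]

lemma decayWeight_le_rpow (hg : 0 < g) {r : ℝ} (hr : g < r) :
    decayWeight g e r ≤ r ^ (-1 - e) := by
  have hr0 : 0 < r := hg.trans hr
  rw [decayWeight, max_eq_left hr.le, Real.rpow_sub hr0, Real.rpow_neg_one]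
  gcongr
  rw [div_le_iff₀ (by positivity), inv_mul_eq_div, le_div_iff₀ hr0, ← sq]
  exact le_add_of_nonneg_left zero_le_one

lemma integrableOn_decayWeight_Ioi (hg : 0 < g) (he : 0 < e) :
    IntegrableOn (decayWeight g e) (Set.Ioi g) := by
  refine Integrable.mono' (integrableOn_Ioi_rpow_of_lt (by linarith : -1 - e < -1) hg)
    (continuous_decayWeight hg he.le).aestronglyMeasurable ?_
  filter_upwards [ae_restrict_mem measurableSet_Ioi] with r hr
  rw [Real.norm_of_nonneg (decayWeight_nonneg (hg.trans hr).le)]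
  exact decayWeight_le_rpow hg hr

lemma integral_decayWeight_Ioi_le (hg : 0 < g) (he : 0 < e) :
    ∫ r in Set.Ioi g, decayWeight g e r ≤ 1 / (e * g ^ e) := by
  have hexp : -1 - e < -1 := by linarith
  calc ∫ r in Set.Ioi g, decayWeight g e r ≤ ∫ r in Set.Ioi g, r ^ (-1 - e) :=
        setIntegral_mono_on (integrableOn_decayWeight_Ioi hg he)
          (integrableOn_Ioi_rpow_of_lt hexp hg) measurableSet_Ioi
          fun r hr => decayWeight_le_rpow hg hr
    _ = 1 / (e * g ^ e) := by
        rw [integral_Ioi_rpow_of_lt hexp hg, show -1 - e + 1 = -e by ring, Real.rpow_neg hg.le]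
        field_simp

lemma integrableOn_decayWeight_Ioc (hg : 0 < g) (he : 0 ≤ e) :
    IntegrableOn (decayWeight g e) (Set.Ioc 0 g) :=
  (continuous_decayWeight hg he).continuousOn.integrableOn_Icc.mono_set Set.Ioc_subset_Icc_self

lemma integrable_decayWeight_abs (hg : 0 < g) (he : 0 < e) :
    Integrable fun t : ℝ => decayWeight g e |t| := by
  have hIoi : IntegrableOn (decayWeight g e) (Set.Ioi 0) := by
    rw [← Set.Ioc_union_Ioi_eq_Ioi hg.le]
    exact (integrableOn_decayWeight_Ioc hg he.le).union (integrableOn_decayWeight_Ioi hg he)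
  refine (integrable_fun_norm_addHaar volume (f := decayWeight g e)).mpr ?_
  simpa using hIoi

lemma integral_decayWeight_abs_le (hg : 0 < g) (he : 0 < e) :
    ∫ t : ℝ, decayWeight g e |t| ≤ Real.log (1 + g ^ 2) / g ^ e + 2 * (1 / (e * g ^ e)) := by
  rw [integral_comp_abs, ← Set.Ioc_union_Ioi_eq_Ioi hg.le,
    setIntegral_union (Set.Ioc_disjoint_Ioi le_rfl) measurableSet_Ioi
      (integrableOn_decayWeight_Ioc hg he.le) (integrableOn_decayWeight_Ioi hg he),
    integral_decayWeight_Ioc hg.le, mul_add]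
  refine add_le_add (le_of_eq (by ring)) ?_
  gcongr
  exact integral_decayWeight_Ioi_le hg he

end DecayWeight

section FirstMoment

lemma integrable_tsum_of_summable_integral_norm {α ι E : Type*} [MeasurableSpace α] [Countable ι]
    [NormedAddCommGroup E] {μ : Measure α} {F : ι → α → E}
    (hm : AEStronglyMeasurable (fun a => ∑' n, F n a) μ) (hF : ∀ n, Integrable (F n) μ)
    (hsum : Summable fun n => ∫ a, ‖F n a‖ ∂μ) : Integrable (fun a => ∑' n, F n a) μ := by
  refine ⟨hm, ?_⟩
  calc ∫⁻ a, ‖∑' n, F n a‖ₑ ∂μ ≤ ∫⁻ a, ∑' n, ‖F n a‖ₑ ∂μ :=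
        lintegral_mono fun a => enorm_tsum_le_tsum_enorm
    _ = ∑' n, ∫⁻ a, ‖F n a‖ₑ ∂μ := lintegral_tsum fun n => (hF n).aestronglyMeasurable.enorm
    _ = ∑' n, ENNReal.ofReal (∫ a, ‖F n a‖ ∂μ) := by
        simp only [ofReal_integral_norm_eq_lintegral_enorm (hF _)]
    _ < ⊤ := hsum.tsum_ofReal_lt_top

lemma continuous_abs_div_one_add_sq : Continuous fun t : ℝ => |t| / (1 + t ^ 2) :=
  Continuous.div (by fun_prop) (by fun_prop) fun t => by positivity

namespace Coefficients.AbsSummable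

variable {c : Coefficients} {M : ℝ} {ξ : ℂ}
  (hc : c.AbsSummable M) (hξ : ‖ξ‖ = 1) (hi : 0 < ξ.im)

include hc hξ hi

lemma norm_smul_pTerm_le (n : ℕ) (t : ℝ) :
    ‖(|t| / (1 + t ^ 2)) • c.pTerm (n + 1) (conj ξ * t)‖ ≤
      ξ.im ^ (-M) * c.a (n + 1) * decayWeight (c.γ (n + 1)) (c.ε (n + 1)) |t| := by
  have hmem : conj ξ * (t : ℂ) ∈ rotatedHalfPlane ξ := conj_mul_mem_rotatedHalfPlane hξ (by simp)
  have hle := hc.norm_pTerm_le_max hξ hi hmem n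
  rw [norm_mul, RCLike.norm_conj, hξ, one_mul, Complex.norm_real, Real.norm_eq_abs] at hle
  rw [norm_smul, Real.norm_of_nonneg (by positivity), decayWeight, sq_abs]
  calc |t| / (1 + t ^ 2) * ‖c.pTerm (n + 1) (conj ξ * t)‖
      ≤ |t| / (1 + t ^ 2) *
          (ξ.im ^ (-M) * (c.a (n + 1) / max |t| (c.γ (n + 1)) ^ c.ε (n + 1))) := by gcongr
    _ = _ := by ring

lemma integrable_smul_pTerm (n : ℕ) :
    Integrable fun t : ℝ => (|t| / (1 + t ^ 2)) • c.pTerm (n + 1) (conj ξ * t) := by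
  have hp : ContinuousOn (c.pTerm (n + 1)) (rotatedHalfPlane ξ) :=
    fun w hw => (hc.continuousAt_pTerm hi hw n).continuousWithinAt
  have hpξ : Continuous fun t : ℝ => c.pTerm (n + 1) (conj ξ * t) :=
    hp.comp_continuous (by fun_prop) fun _ => conj_mul_mem_rotatedHalfPlane hξ (by simp)
  exact ((integrable_decayWeight_abs (hc.γ_pos n) (hc.ε_pos n)).const_mul _).mono'
    (continuous_abs_div_one_add_sq.smul hpξ).aestronglyMeasurable
    (ae_of_all _ (hc.norm_smul_pTerm_le hξ hi n))

lemma integral_norm_smul_pTerm_le (n : ℕ) :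
    ∫ t : ℝ, ‖(|t| / (1 + t ^ 2)) • c.pTerm (n + 1) (conj ξ * t)‖ ≤ ξ.im ^ (-M) *
      (c.a (n + 1) * Real.log (1 + c.γ (n + 1) ^ 2) / c.γ (n + 1) ^ c.ε (n + 1) +
        2 * (c.a (n + 1) / (c.ε (n + 1) * c.γ (n + 1) ^ c.ε (n + 1)))) := by
  have ha := hc.a_nonneg n
  refine (integral_mono (hc.integrable_smul_pTerm hξ hi n).norm
    ((integrable_decayWeight_abs (hc.γ_pos n) (hc.ε_pos n)).const_mul _)
    (hc.norm_smul_pTerm_le hξ hi n)).trans ?_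
  rw [integral_const_mul]
  calc ξ.im ^ (-M) * c.a (n + 1) * ∫ t : ℝ, decayWeight (c.γ (n + 1)) (c.ε (n + 1)) |t|
      ≤ ξ.im ^ (-M) * c.a (n + 1) *
          (Real.log (1 + c.γ (n + 1) ^ 2) / c.γ (n + 1) ^ c.ε (n + 1) +
            2 * (1 / (c.ε (n + 1) * c.γ (n + 1) ^ c.ε (n + 1)))) := by
        gcongr
        exact integral_decayWeight_abs_le (hc.γ_pos n) (hc.ε_pos n)
    _ = _ := by ring

lemma integrable_smul_p
    (hlog : Summable fun n : ℕ =>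
      c.a (n + 1) * Real.log (1 + c.γ (n + 1) ^ 2) / c.γ (n + 1) ^ c.ε (n + 1))
    (hε : Summable fun n : ℕ => c.a (n + 1) / (c.ε (n + 1) * c.γ (n + 1) ^ c.ε (n + 1))) :
    Integrable fun t : ℝ => (|t| / (1 + t ^ 2)) • c.p (conj ξ * t) := by
  have hp : Continuous fun t : ℝ => c.p (conj ξ * t) :=
    (hc.continuousOn_p hξ hi).comp_continuous (by fun_prop)
      fun _ => conj_mul_mem_rotatedHalfPlane hξ (by simp)
  have htsum (t : ℝ) : (|t| / (1 + t ^ 2)) • c.p (conj ξ * t) =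
      ∑' n, (|t| / (1 + t ^ 2)) • c.pTerm (n + 1) (conj ξ * t) := (tsum_const_smul'' _).symm
  have hmeas : AEStronglyMeasurable fun t : ℝ => (|t| / (1 + t ^ 2)) • c.p (conj ξ * t) :=
    (continuous_abs_div_one_add_sq.smul hp).aestronglyMeasurable
  simp only [htsum] at hmeas ⊢
  refine integrable_tsum_of_summable_integral_norm hmeas (hc.integrable_smul_pTerm hξ hi) ?_
  exact .of_nonneg_of_le (fun n => integral_nonneg fun t => norm_nonneg _)
    (hc.integral_norm_smul_pTerm_le hξ hi) ((hlog.add (hε.mul_left 2)).mul_left _)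

lemma integrable_abs_withDensity
    (hlog : Summable fun n : ℕ =>
      c.a (n + 1) * Real.log (1 + c.γ (n + 1) ^ 2) / c.γ (n + 1) ^ c.ε (n + 1))
    (hε : Summable fun n : ℕ => c.a (n + 1) / (c.ε (n + 1) * c.γ (n + 1) ^ c.ε (n + 1))) :
    Integrable (fun t : ℝ => |t|) (volume.withDensity fun t : ℝ =>
      ENNReal.ofReal ((c.rotated ξ t - t).im / (Real.pi * (1 + t ^ 2)))) := by
  have hcont : Continuous fun t : ℝ => c.rotated ξ t - t :=
    (hc.continuousOn_rotated_sub hξ hi).comp_continuous (by fun_prop) fun _ => by simp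
  have hmeas : Measurable fun t : ℝ =>
      ENNReal.ofReal ((c.rotated ξ t - t).im / (Real.pi * (1 + t ^ 2))) :=
    ((Complex.measurable_im.comp hcont.measurable).div (by fun_prop)).ennreal_ofReal
  have hint := (((hc.integrable_smul_p hξ hi hlog hε).const_mul ξ).im.div_const Real.pi).pos_part
  rw [integrable_withDensity_iff_integrable_smul' hmeas
    (ae_of_all _ fun t => ENNReal.ofReal_lt_top)]
  refine hint.congr (ae_of_all _ fun t => ?_)
  beta_reduce
  rw [ENNReal.toReal_ofReal', rotated_sub hξ, smul_eq_mul, max_mul_of_nonneg _ _ (abs_nonneg t),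
    zero_mul, mul_smul_comm, RCLike.im_to_complex, Complex.smul_im, smul_eq_mul]
  congr 1
  field_simp

end Coefficients.AbsSummable

end FirstMoment

lemma norm_rot (a b : ℝ) : ‖rot a b‖ = 1 := by
  rw [rot, mul_comm, Complex.norm_exp_ofReal_mul_I]

lemma rot_im_pos {a b : ℝ} (ha : 0 ≤ a) (hab : a < b) (hb : b ≤ Real.pi) : 0 < (rot a b).im := by
  rw [rot, mul_comm, Complex.exp_ofReal_mul_I_im, opening]
  exact Real.sin_pos_of_pos_of_lt_pi (by linarith) (by linarith)

end SlopeExample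

open SlopeExample in
theorem proposition3p3_general {ξ : ℂ} (hξ : ‖ξ‖ = 1) (hi : 0 < ξ.im) {c : Coefficients} {M : ℝ}
    (hc : c.AbsSummable M) {β : ℝ} {μ : Measure ℝ} [IsFiniteMeasure μ]
    (hrep : IsRepresentedBy (c.rotated ξ) β μ) :
    μ ≪ (volume : Measure ℝ) ∧
    (∃ vstar : ℝ → ℝ,
      (∀ x : ℝ, 0 ≤ vstar x ∧
        Tendsto (fun y : ℝ =>
            (c.rotated ξ ((x : ℂ) + (y : ℂ) * Complex.I) - ((x : ℂ) + (y : ℂ) * Complex.I)).im)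
          (𝓝[>] 0) (𝓝 (vstar x))) ∧
      μ = (volume : Measure ℝ).withDensity
        (fun t => ENNReal.ofReal (vstar t / (Real.pi * (1 + t ^ 2))))) ∧
    ((Summable fun n : ℕ =>
          c.a (n + 1) * Real.log (1 + c.γ (n + 1) ^ 2) / c.γ (n + 1) ^ c.ε (n + 1)) →
      (Summable fun n : ℕ => c.a (n + 1) / (c.ε (n + 1) * c.γ (n + 1) ^ c.ε (n + 1))) →
      Integrable (fun t : ℝ => |t|) μ) ∧
    (Integrable (fun t : ℝ => |t|) μ → β = ∫ t : ℝ, t ∂μ) := by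
  have hden (z : ℂ) : 0 < Real.pi * (1 + z.re ^ 2) := by positivity
  have hv : ContinuousOn (fun z => (c.rotated ξ z - z).im) {z | 0 ≤ z.im} :=
    Complex.continuous_im.comp_continuousOn (hc.continuousOn_rotated_sub hξ hi)
  have hw : ContinuousOn (fun z => (c.rotated ξ z - z).im / (Real.pi * (1 + z.re ^ 2)))
      {z | 0 ≤ z.im} := hv.div (by fun_prop) fun z _ => (hden z).ne'
  have hpoisson (z : ℂ) (hz : 0 < z.im) :
      (c.rotated ξ z - z).im / (Real.pi * (1 + z.re ^ 2)) =
        ∫ t, weightedPoisson z.re z.im t ∂μ := by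
    rw [hrep.im_sub hz, mul_div_cancel_left₀ _ (hden z).ne']
  have hμ := eq_withDensity_boundary hw hpoisson
  refine ⟨hμ ▸ withDensity_absolutelyContinuous _ _, ⟨fun x => (c.rotated ξ x - x).im,
    fun x => ⟨?_, tendsto_boundary hv x⟩, hμ⟩, fun hlog hε => ?_, fun hint => ?_⟩
  · simpa using (le_div_iff₀ (hden x)).mp (boundary_nonneg hw hpoisson x)
  · exact hμ ▸ hc.integrable_abs_withDensity hξ hi hlog hε
  · have hlim := tendsto_nhds_unique (hrep.tendsto_sub hint) (hc.tendsto_rotated_sub hξ hi)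
    exact sub_eq_zero.mp (by exact_mod_cast hlim)

theorem proposition3p3 (a b : ℝ) (ha : 0 ≤ a) (hab : a < b) (hb : b ≤ Real.pi)
    (hne : ¬ (a = 0 ∧ b = Real.pi))
    (c : SlopeExample.Coefficients) (hc : c.Admissible (SlopeExample.opening a b))
    (β : ℝ) (μ : Measure ℝ) [IsFiniteMeasure μ]
    (hrep : SlopeExample.IsRepresentedBy (c.f a b) β μ) :
    μ ≪ (volume : Measure ℝ) ∧
    (∃ vstar : ℝ → ℝ,
      (∀ x : ℝ, 0 ≤ vstar x ∧
        Tendsto (fun y : ℝ =>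
            (c.f a b ((x : ℂ) + (y : ℂ) * Complex.I) - ((x : ℂ) + (y : ℂ) * Complex.I)).im)
          (𝓝[>] 0) (𝓝 (vstar x))) ∧
      μ = (volume : Measure ℝ).withDensity
        (fun t => ENNReal.ofReal (vstar t / (Real.pi * (1 + t ^ 2))))) ∧
    ((Summable fun n : ℕ =>
          c.a (n + 1) * Real.log (1 + c.γ (n + 1) ^ 2) / c.γ (n + 1) ^ c.ε (n + 1)) →
      (Summable fun n : ℕ => c.a (n + 1) / (c.ε (n + 1) * c.γ (n + 1) ^ c.ε (n + 1))) →
      Integrable (fun t : ℝ => |t|) μ) ∧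
    (Integrable (fun t : ℝ => |t|) μ → β = ∫ t : ℝ, t ∂μ) := by
  exact proposition3p3_general (SlopeExample.norm_rot a b) (SlopeExample.rot_im_pos ha hab hb)
    hc.absSummable hrep
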